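/- **Setting.** For $d\ge 0$ let $Z_d\sim EC_d(0,I)$, i.e. $Z_d$ is a random vector in $\mathbb R^d$ whose law $\nu_d$ has a density $f_d(z)\propto g_d(\|z\|_2^2)$ for some continuous nonnegative function $g_d$ on $[0,\infty)$, and let $(u_d)$ be real constants, depending only on $d$, with $\|Z_d\|_2^2/u_d\to 1$ in probability as $d\to\infty$. For a $p\times p$ correlation matrix $\Sigma$ (positive semidefinite with unit diagonal) of rank $d$, a standard elliptical vector $X\sim EC_p(0,\Sigma)$ is a random vector in $\mathbb R^p$ with the same law as $L^TZ_d$ for some $d\times p$ matrix $L$ with $L^TL=\Sigma$. Write $\|X\|_\infty=\max_{1\le j\le p}|X_j|$. **Theorem.** 1. (ReX bound for degenerate elliptical vectors) For every $\delta>0$, $$\lim_{p,d\to\infty}\mathbb P\left(\frac{\|X\|_\infty}{\sqrt{u_d(1-p^{-2/(d-1)})}}>1+\delta\right)=0,$$ uniformly over all correlation matrices $\Sigma\in\mathbb R^{p\times p}$ of rank $d$ and all $X\sim EC_p(0,\Sigma)$. That is, for all $\delta,\varepsilon>0$ there is $N$ such that the probability is less than $\varepsilon$ for all $p,d\ge N$,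 all such $\Sigma$ and all such $X$. 2. (ReX bound for degenerate Gaussian vectors) For every $\delta>0$, $$\lim_{p,d\to\infty}\mathbb P\left(\frac{\|X\|_\infty}{\sqrt{d(1-p^{-2/(d-1)})}}>1+\delta\right)=0,$$ uniformly over all correlation matrices $\Sigma\in\mathbb R^{p\times p}$ of rank $d$ and $X\sim N_p(0,\Sigma)$. 3. If $d=d(p)$ satisfies $(\log\log p)^2\,d/(\log p)^2\to\infty$ as $p\to\infty$, then $$\lim_{p\to\infty}\mathbb P\left(\frac{\|X\|_\infty}{\sqrt{d(1-p^{-2/(d-1)})}}\le 1\right)=1,$$ uniformly over all correlation matrices $\Sigma\in\mathbb R^{p\times p}$ of rank $d(p)$ and $X\sim N_p(0,\Sigma)$. -/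

import Mathlib

open MeasureTheory ProbabilityTheory Filter Topology Matrix

/-- `ν` is the law of a nondegenerate elliptical vector with location `ξ` and positive definite
scatter matrix `Θ`: a probability measure on `ℝ^p` with Lebesgue density
`f(v) = c * g((v - ξ)ᵀ Θ⁻¹ (v - ξ))` for a continuous nonnegative `g` on `[0, ∞)` and a
normalising constant `c > 0`. (Integrability of `f` is part of `ν` being a probability measure.) -/
def IsEllipticalLaw {p : ℕ} (ξ : EuclideanSpace ℝ (Fin p)) (Θ : Matrix (Fin p) (Fin p) ℝ)
    (ν : Measure (EuclideanSpace ℝ (Fin p))) : Prop :=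
  IsProbabilityMeasure ν ∧ Θ.PosDef ∧
    ∃ g : ℝ → ℝ, ContinuousOn g (Set.Ici 0) ∧ (∀ t, 0 ≤ t → 0 ≤ g t) ∧
      ∃ c : ℝ, 0 < c ∧
        ν = volume.withDensity fun v =>
          ENNReal.ofReal (c * g ((v - ξ).ofLp ⬝ᵥ (Θ⁻¹ *ᵥ (v - ξ).ofLp)))

/-- `S` is a correlation matrix: positive semidefinite with unit diagonal. -/
def IsCorrelationMatrix {p : ℕ} (S : Matrix (Fin p) (Fin p) ℝ) : Prop :=
  S.PosSemidef ∧ ∀ j, S j j = 1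

/-- The (possibly degenerate) centred elliptical vector `X ∼ EC_p(0, S)`, where `S` has rank `d`
and `ν` is the law of the underlying spherical vector `Z ∼ EC_d(0, I)`: `S = Lᵀ L` for some
`d × p` matrix `L`, and `X` has the law of `Lᵀ Z`. -/
def IsEllipticalVector {p d : ℕ} {Ω : Type*} [MeasurableSpace Ω]
    (ν : Measure (EuclideanSpace ℝ (Fin d))) (S : Matrix (Fin p) (Fin p) ℝ)
    (X : Ω → EuclideanSpace ℝ (Fin p)) (P : Measure Ω) : Prop :=
  S.rank = d ∧ ∃ L : Matrix (Fin d) (Fin p) ℝ, Lᵀ * L = S ∧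
    HasLaw X (ν.map fun z => WithLp.toLp 2 (Lᵀ *ᵥ z.ofLp)) P

/-- `‖x‖_∞ = max_j |x_j|`. -/
noncomputable def maxNorm {p : ℕ} (x : EuclideanSpace ℝ (Fin p)) : ℝ := ⨆ j, |x j|

/-- The bound `√(u (1 - p^(-2/(d-1))))`. -/
noncomputable def rexBound (u : ℝ) (p d : ℕ) : ℝ :=
  √(u * (1 - (p : ℝ) ^ (-2 / ((d : ℝ) - 1))))

/-! ### The standard Gaussian measure: density, tilting and tails -/

section Gaussian

variable {E : Type*} [NormedAddCommGroup E] [InnerProductSpace ℝ E] [FiniteDimensional ℝ E]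
  [MeasurableSpace E] [BorelSpace E]

theorem integrable_exp_neg_mul_sq_norm {b : ℝ} (hb : 0 < b) :
    Integrable fun v : E => Real.exp (-b * ‖v‖ ^ 2) := by
  refine not_imp_comm.1 integral_undef ?_
  rw [GaussianFourier.integral_rexp_neg_mul_sq_norm hb]
  positivity

theorem stdGaussian_map_inv_sqrt_smul {q : ℝ} (hq : 0 < q) :
    (stdGaussian E).map ((√q)⁻¹ • ·) = volume.withDensity fun v : E =>
      ENNReal.ofReal ((q / (2 * Real.pi)) ^ (Module.finrank ℝ E / 2 : ℝ) *
        Real.exp (-(q / 2) * ‖v‖ ^ 2)) := by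
  have hint := (integrable_exp_neg_mul_sq_norm (E := E) (half_pos hq)).const_mul
    ((q / (2 * Real.pi)) ^ (Module.finrank ℝ E / 2 : ℝ))
  have : IsFiniteMeasure (volume.withDensity fun v : E =>
      ENNReal.ofReal ((q / (2 * Real.pi)) ^ (Module.finrank ℝ E / 2 : ℝ) *
        Real.exp (-(q / 2) * ‖v‖ ^ 2))) :=
    isFiniteMeasure_withDensity_ofReal hint.2
  have : IsProbabilityMeasure ((stdGaussian E).map ((√q)⁻¹ • ·)) :=
    Measure.isProbabilityMeasure_map (by fun_prop)
  refine Measure.ext_of_charFun (funext fun t => ?_)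
  rw [charFun_map_smul, charFun_stdGaussian, charFun_apply,
    integral_withDensity_eq_integral_toReal_smul (by fun_prop) (by simp)]
  have h0 : ∀ v : E, (ENNReal.ofReal ((q / (2 * Real.pi)) ^ (Module.finrank ℝ E / 2 : ℝ) *
        Real.exp (-(q / 2) * ‖v‖ ^ 2))).toReal • Complex.exp ((inner ℝ v t : ℝ) * Complex.I) =
      ((q / (2 * Real.pi)) ^ (Module.finrank ℝ E / 2 : ℝ) : ℝ) *
        Complex.exp (-((q / 2 : ℝ) : ℂ) * ‖v‖ ^ 2 + Complex.I * (inner ℝ t v : ℝ)) := by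
    intro v
    rw [ENNReal.toReal_ofReal (by positivity), Complex.exp_add, real_inner_comm, Complex.real_smul]
    push_cast
    rw [mul_comm Complex.I]
    ring
  simp_rw [h0]
  rw [integral_const_mul, GaussianFourier.integral_cexp_neg_mul_sq_norm_add (by simpa using hq)]
  rw [← mul_assoc]
  have h1 : (((q / (2 * Real.pi)) ^ (Module.finrank ℝ E / 2 : ℝ) : ℝ) : ℂ) *
      (Real.pi / ((q / 2 : ℝ) : ℂ)) ^ (Module.finrank ℝ E / 2 : ℂ) = 1 := by
    have : (Real.pi / ((q / 2 : ℝ) : ℂ)) ^ (Module.finrank ℝ E / 2 : ℂ) =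
        (((Real.pi / (q / 2)) ^ (Module.finrank ℝ E / 2 : ℝ) : ℝ) : ℂ) := by
      rw [Complex.ofReal_cpow (by positivity)]
      push_cast
      rfl
    rw [this, ← Complex.ofReal_mul, ← Real.mul_rpow (by positivity) (by positivity)]
    have : q / (2 * Real.pi) * (Real.pi / (q / 2)) = 1 := by field_simp
    simp [this]
  have h2 : ‖(√q)⁻¹ • t‖ ^ 2 = q⁻¹ * ‖t‖ ^ 2 := by
    rw [norm_smul, mul_pow, Real.norm_eq_abs, sq_abs, inv_pow, Real.sq_sqrt hq.le]
  rw [h1, one_mul, ← Complex.ofReal_pow, h2, Complex.I_sq]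
  congr 1
  push_cast
  have : (q : ℂ) ≠ 0 := by exact_mod_cast hq.ne'
  field_simp
  ring

theorem stdGaussian_eq_withDensity : stdGaussian E = volume.withDensity fun v : E =>
    ENNReal.ofReal ((1 / (2 * Real.pi)) ^ (Module.finrank ℝ E / 2 : ℝ) *
      Real.exp (-(1 / 2) * ‖v‖ ^ 2)) := by
  rw [← stdGaussian_map_inv_sqrt_smul one_pos]
  simp

theorem setLIntegral_exp_stdGaussian {q : ℝ} (hq : 0 < q) {s : Set E} (hs : MeasurableSet s) :
    ∫⁻ z in s, ENNReal.ofReal (Real.exp (-((q - 1) / 2) * ‖z‖ ^ 2)) ∂(stdGaussian E) =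
      ENNReal.ofReal (q ^ (-(Module.finrank ℝ E / 2 : ℝ))) *
        stdGaussian E {z | (√q)⁻¹ • z ∈ s} := by
  have h1 : stdGaussian E {z | (√q)⁻¹ • z ∈ s} = (stdGaussian E).map ((√q)⁻¹ • ·) s := by
    rw [Measure.map_apply (by fun_prop) hs]; rfl
  rw [h1, stdGaussian_map_inv_sqrt_smul hq, stdGaussian_eq_withDensity, withDensity_apply _ hs,
    setLIntegral_withDensity_eq_setLIntegral_mul _ (by fun_prop) (by fun_prop) hs,
    ← lintegral_const_mul _ (by fun_prop)]
  refine lintegral_congr fun v => ?_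
  rw [Pi.mul_apply, ← ENNReal.ofReal_mul (by positivity), ← ENNReal.ofReal_mul (by positivity)]
  congr 1
  rw [mul_assoc, ← Real.exp_add, ← mul_assoc, div_eq_mul_one_div q,
    Real.mul_rpow hq.le (by positivity), ← mul_assoc, ← Real.rpow_add hq]
  simp only [neg_add_cancel, Real.rpow_zero, one_mul]
  congr 2
  ring

/-- Mills' bound for the two-sided Gaussian tail. -/
theorem gaussianReal_abs_gt_le {x : ℝ} (hx : 0 < x) :
    (gaussianReal 0 1).real {y | x < |y|} ≤ Real.exp (-x ^ 2 / 2) / x := by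
  have hderiv : ∀ y : ℝ, HasDerivAt (fun y : ℝ => -Real.exp (-y ^ 2 / 2)) (y * Real.exp (-y ^ 2 / 2)) y := by
    intro y
    have := (((hasDerivAt_pow 2 y).neg.div_const 2).exp).neg
    convert! this using 1
    simp; ring
  have htend : Tendsto (fun y : ℝ => -Real.exp (-y ^ 2 / 2)) atTop (𝓝 0) := by
    rw [← neg_zero]
    refine (Real.tendsto_exp_atBot.comp ?_).neg
    simp_rw [neg_div]
    exact tendsto_neg_atTop_atBot.comp ((tendsto_pow_atTop two_ne_zero).atTop_div_const two_pos)
  have hpos : ∀ y ∈ Set.Ioi x, 0 ≤ y * Real.exp (-y ^ 2 / 2) := fun y hy =>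
    mul_nonneg (hx.trans hy).le (Real.exp_pos _).le
  have hI := integral_Ioi_of_hasDerivAt_of_nonneg' (fun y _ => hderiv y) hpos htend
  have hInt := integrableOn_Ioi_deriv_of_nonneg' (fun y _ => hderiv y) hpos htend
  have hI' : (gaussianReal 0 1).real (Set.Ioi x) ≤ (√(2 * Real.pi))⁻¹ * Real.exp (-x ^ 2 / 2) / x := by
    rw [measureReal_def, gaussianReal_apply_eq_integral _ one_ne_zero, ENNReal.toReal_ofReal
      (integral_nonneg fun _ => gaussianPDFReal_nonneg _ _ _)]
    calc ∫ y in Set.Ioi x, gaussianPDFReal 0 1 y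
        ≤ ∫ y in Set.Ioi x, ((√(2 * Real.pi))⁻¹ / x) * (y * Real.exp (-y ^ 2 / 2)) := by
          refine setIntegral_mono_on (integrable_gaussianPDFReal 0 1).integrableOn
            (hInt.const_mul _) measurableSet_Ioi fun y hy => ?_
          have hy : x < y := hy
          simp only [gaussianPDFReal, sub_zero, NNReal.coe_one, mul_one]
          rw [div_mul_eq_mul_div, mul_div_assoc]
          gcongr
          rw [mul_div_right_comm]
          exact le_mul_of_one_le_left (Real.exp_pos _).le ((one_le_div hx).2 hy.le)
      _ = _ := by rw [integral_const_mul, hI]; ring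
  have hsymm : (gaussianReal 0 1).real (Set.Iio (-x)) = (gaussianReal 0 1).real (Set.Ioi x) := by
    have := gaussianReal_map_neg (μ := 0) (v := 1)
    rw [neg_zero] at this
    conv_lhs => rw [← this]
    rw [map_measureReal_apply measurable_neg measurableSet_Iio]
    simp
  have hset : {y : ℝ | x < |y|} = Set.Ioi x ∪ Set.Iio (-x) := by
    ext y; simp [lt_abs, lt_neg]
  have h2 : 2 ≤ √(2 * Real.pi) := Real.le_sqrt_of_sq_le (by nlinarith [Real.pi_gt_three])
  calc (gaussianReal 0 1).real {y | x < |y|} ≤ _ := hset ▸ measureReal_union_le _ _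
    _ ≤ 2 * ((√(2 * Real.pi))⁻¹ * Real.exp (-x ^ 2 / 2) / x) := by rw [hsymm]; linarith
    _ = (2 * (√(2 * Real.pi))⁻¹) * (Real.exp (-x ^ 2 / 2) / x) := by ring
    _ ≤ 1 * (Real.exp (-x ^ 2 / 2) / x) := by
        gcongr
        rw [← div_eq_mul_inv, div_le_one (by positivity)]; exact h2
    _ = _ := one_mul _

theorem stdGaussian_map_inner {l : E} (hl : ‖l‖ = 1) :
    (stdGaussian E).map (fun z => inner ℝ l z) = gaussianReal 0 1 := by
  have h := IsGaussian.map_eq_gaussianReal (μ := stdGaussian E) (innerSL ℝ l)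
  rw [integral_strongDual_stdGaussian, variance_dual_stdGaussian] at h
  simpa [hl] using h

/-- The probability that a standard Gaussian vector lies in a ball and is far away from a
hyperplane through the centre, bounded by an exponential change of measure. -/
theorem stdGaussian_abs_inner_gt_norm_le {l : E} (hl : ‖l‖ = 1) {q b D : ℝ} (hq : 1 ≤ q)
    (hb : 0 < b) :
    (stdGaussian E).real {z | b < |inner ℝ l z| ∧ ‖z‖ ^ 2 ≤ D} ≤
      Real.exp ((q - 1) / 2 * D) * q ^ (-(Module.finrank ℝ E / 2 : ℝ)) *
        (Real.exp (-(b * √q) ^ 2 / 2) / (b * √q)) := by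
  have hq0 : 0 < q := one_pos.trans_le hq
  set s := {z : E | b < |inner ℝ l z| ∧ ‖z‖ ^ 2 ≤ D}
  have hs : MeasurableSet s :=
    MeasurableSet.inter (s₁ := {z : E | b < |inner ℝ l z|}) (s₂ := {z | ‖z‖ ^ 2 ≤ D})
      (measurableSet_lt (by fun_prop) (by fun_prop)) (measurableSet_le (by fun_prop) (by fun_prop))
  have key : stdGaussian E s ≤ ENNReal.ofReal (Real.exp ((q - 1) / 2 * D)) *
      ∫⁻ z in s, ENNReal.ofReal (Real.exp (-((q - 1) / 2) * ‖z‖ ^ 2)) ∂(stdGaussian E) := by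
    rw [← lintegral_const_mul _ (by fun_prop), ← setLIntegral_one]
    refine setLIntegral_mono' hs fun z hz => ?_
    rw [← ENNReal.ofReal_mul (by positivity), ← Real.exp_add, ENNReal.one_le_ofReal]
    refine Real.one_le_exp ?_
    nlinarith [hz.2, mul_le_mul_of_nonneg_left hz.2 (sub_nonneg.2 hq)]
  rw [setLIntegral_exp_stdGaussian hq0 hs] at key
  have hsub : stdGaussian E {z | (√q)⁻¹ • z ∈ s} ≤ gaussianReal 0 1 {y | b * √q < |y|} := by
    rw [← stdGaussian_map_inner hl, Measure.map_apply (by fun_prop)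
      (measurableSet_lt (by fun_prop) (by fun_prop))]
    refine measure_mono fun z hz => ?_
    have h1 := hz.1
    rw [inner_smul_right, abs_mul, abs_of_pos (by positivity), inv_mul_eq_div,
      lt_div_iff₀ (by positivity)] at h1
    exact h1
  have h2 := ENNReal.toReal_mono (by finiteness) (key.trans (mul_le_mul_right (mul_le_mul_right hsub _) _))
  rw [ENNReal.toReal_mul, ENNReal.toReal_mul, ENNReal.toReal_ofReal (by positivity),
    ENNReal.toReal_ofReal (by positivity), ← mul_assoc] at h2
  refine h2.trans ?_
  gcongr
  exact gaussianReal_abs_gt_le (by positivity)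

theorem stdGaussian_norm_sq_chernoff {a D : ℝ} (ha : |a| ≤ 1 / 4) :
    (stdGaussian E).real {z | a * D ≤ a * ‖z‖ ^ 2} ≤
      Real.exp (-(a * D) / 2 + Module.finrank ℝ E / 2 * (a + a ^ 2)) := by
  have ha' := abs_le.1 ha
  have hq0 : 0 < 1 - a := by linarith
  set s := {z : E | a * D ≤ a * ‖z‖ ^ 2}
  have hs : MeasurableSet s := measurableSet_le (by fun_prop) (by fun_prop)
  have key : stdGaussian E s ≤ ENNReal.ofReal (Real.exp (-(a * D) / 2)) *
      ∫⁻ z in s, ENNReal.ofReal (Real.exp (-(((1 - a) - 1) / 2) * ‖z‖ ^ 2)) ∂(stdGaussian E) := by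
    rw [← lintegral_const_mul _ (by fun_prop), ← setLIntegral_one]
    refine setLIntegral_mono' hs fun z hz => ?_
    rw [← ENNReal.ofReal_mul (by positivity), ← Real.exp_add, ENNReal.one_le_ofReal]
    refine Real.one_le_exp ?_
    have : a * D ≤ a * ‖z‖ ^ 2 := hz
    linarith
  rw [setLIntegral_exp_stdGaussian hq0 hs] at key
  have h2 := ENNReal.toReal_mono (by finiteness) (key.trans (mul_le_mul_right (mul_le_mul_right
    prob_le_one _) _))
  rw [ENNReal.toReal_mul, ENNReal.toReal_mul, ENNReal.toReal_ofReal (by positivity),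
    ENNReal.toReal_ofReal (by positivity), ENNReal.toReal_one, mul_one] at h2
  refine h2.trans ?_
  rw [Real.rpow_def_of_pos hq0, ← Real.exp_add, Real.exp_le_exp]
  have hlog : -(a + a ^ 2) ≤ Real.log (1 - a) := by
    have h := (abs_le.1 (Real.abs_log_sub_add_sum_range_le (by linarith : |a| < 1) 2)).1
    have h3 : |a| ^ (2 + 1) / (1 - |a|) ≤ a ^ 2 / 2 := by
      rw [div_le_iff₀ (by linarith), pow_succ, sq_abs]
      nlinarith [sq_nonneg a, mul_le_mul_of_nonneg_left ha (sq_nonneg a)]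
    norm_num [Finset.sum_range_succ] at h h3
    linarith
  have hn : (0 : ℝ) ≤ Module.finrank ℝ E / 2 := by positivity
  linarith [mul_le_mul_of_nonneg_left hlog hn]

/-- Concentration of the norm of a standard Gaussian vector. -/
theorem stdGaussian_norm_sq_gt_le {t : ℝ} (ht : 0 ≤ t) (ht1 : t ≤ 1 / 2) :
    (stdGaussian E).real {z | Module.finrank ℝ E * (1 + t) ≤ ‖z‖ ^ 2} ≤
      Real.exp (-(Module.finrank ℝ E * t ^ 2 / 8)) := by
  rcases ht.eq_or_lt with rfl | ht
  · simp
  have h := stdGaussian_norm_sq_chernoff (E := E) (a := t / 2)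
    (D := Module.finrank ℝ E * (1 + t)) (by rw [abs_of_nonneg] <;> linarith)
  simp only [mul_le_mul_iff_right₀ (half_pos ht)] at h
  refine h.trans (Real.exp_le_exp.2 (le_of_eq ?_))
  ring

theorem stdGaussian_norm_sq_lt_le {t : ℝ} (ht : 0 ≤ t) (ht1 : t ≤ 1 / 2) :
    (stdGaussian E).real {z | ‖z‖ ^ 2 ≤ Module.finrank ℝ E * (1 - t)} ≤
      Real.exp (-(Module.finrank ℝ E * t ^ 2 / 8)) := by
  rcases ht.eq_or_lt with rfl | ht
  · simp
  have h := stdGaussian_norm_sq_chernoff (E := E) (a := -(t / 2))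
    (D := Module.finrank ℝ E * (1 - t)) (by rw [abs_neg, abs_of_nonneg] <;> linarith)
  simp only [neg_mul, neg_le_neg_iff, mul_le_mul_iff_right₀ (half_pos ht)] at h
  refine h.trans (Real.exp_le_exp.2 (le_of_eq ?_))
  ring

end Gaussian

/-! ### Independence of norm and direction for spherical laws -/

section Polar

open Set Metric

variable {E : Type*} [NormedAddCommGroup E] [NormedSpace ℝ E] [FiniteDimensional ℝ E]
  [Nontrivial E] [MeasurableSpace E] [BorelSpace E] (μ : Measure E) [μ.IsAddHaarMeasure]

/-- A measure with a radial density gives the intersection of a cone and a radial set a mass that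
factors through polar coordinates. -/
theorem withDensity_norm_cone_inter {h : ℝ → ENNReal} (hh : Measurable h) {A : Set E}
    (hA : MeasurableSet A) (hcone : ∀ (c : ℝ) (x : E), 0 < c → x ∈ A → c • x ∈ A)
    {B : Set ℝ} (hB : MeasurableSet B) :
    μ.withDensity (fun v => h ‖v‖) (A ∩ {v | ‖v‖ ∈ B}) =
      μ.toSphere ((↑) ⁻¹' A) *
        ∫⁻ r : Ioi (0 : ℝ), B.indicator h r ∂(Measure.volumeIoiPow (Module.finrank ℝ E - 1)) := by
  have hnB : MeasurableSet {v : E | ‖v‖ ∈ B} := measurable_norm hB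
  have hA' : ∀ (c : ℝ) (x : E), 0 < c → (c • x ∈ A ↔ x ∈ A) := fun c x hc =>
    ⟨fun hx => by simpa [smul_smul, hc.ne'] using hcone c⁻¹ _ (inv_pos.2 hc) hx, hcone c x hc⟩
  have hmeasA : MeasurableSet ((↑) ⁻¹' A : Set (sphere (0 : E) 1)) := measurable_subtype_coe hA
  set F : sphere (0 : E) 1 × Ioi (0 : ℝ) → ENNReal :=
    fun y => ((↑) ⁻¹' A : Set (sphere (0 : E) 1)).indicator 1 y.1 * B.indicator h y.2
  have hmeas : Measurable (fun r : Ioi (0 : ℝ) => B.indicator h r) :=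
    (hh.indicator hB).comp measurable_subtype_coe
  calc μ.withDensity (fun v => h ‖v‖) (A ∩ {v | ‖v‖ ∈ B})
      = ∫⁻ v, (A ∩ {v | ‖v‖ ∈ B}).indicator (fun v => h ‖v‖) v ∂μ := by
        rw [withDensity_apply _ (hA.inter hnB), lintegral_indicator (hA.inter hnB)]
    _ = ∫⁻ v in ({0}ᶜ : Set E), (A ∩ {v | ‖v‖ ∈ B}).indicator (fun v => h ‖v‖) v ∂μ := by
        rw [restrict_compl_singleton]
    _ = ∫⁻ v : ({0}ᶜ : Set E), (A ∩ {v | ‖v‖ ∈ B}).indicator (fun v => h ‖v‖) (v : E)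
          ∂(μ.comap (↑)) := (lintegral_subtype_comap (measurableSet_singleton _).compl _).symm
    _ = ∫⁻ v : ({0}ᶜ : Set E), F (homeomorphUnitSphereProd E v) ∂(μ.comap (↑)) := by
        refine lintegral_congr fun v => ?_
        have hv : 0 < ‖(v : E)‖ := norm_pos_iff.2 v.2
        have hmem : ‖(v : E)‖⁻¹ • (v : E) ∈ A ↔ (v : E) ∈ A := hA' _ _ (inv_pos.2 hv)
        by_cases h1 : (v : E) ∈ A <;> by_cases h2 : ‖(v : E)‖ ∈ B <;>
          simp [F, indicator, hmem, h1, h2]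
    _ = ∫⁻ y, F y ∂(μ.toSphere.prod (Measure.volumeIoiPow (Module.finrank ℝ E - 1))) :=
        μ.measurePreserving_homeomorphUnitSphereProd.lintegral_comp
          (((measurable_one.indicator hmeasA).comp measurable_fst).mul (hmeas.comp measurable_snd))
    _ = _ := by
        rw [lintegral_prod_mul (measurable_one.indicator hmeasA).aemeasurable hmeas.aemeasurable,
          lintegral_indicator_one hmeasA]

/-- For two spherical probability laws, the direction has the same law and is independent of the
norm. -/
theorem withDensity_norm_cone_mul {h k : ℝ → ENNReal} (hh : Measurable h) (hk : Measurable k)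
    [IsProbabilityMeasure (μ.withDensity fun v => h ‖v‖)]
    [IsProbabilityMeasure (μ.withDensity fun v => k ‖v‖)] {A : Set E}
    (hA : MeasurableSet A) (hcone : ∀ (c : ℝ) (x : E), 0 < c → x ∈ A → c • x ∈ A)
    {B : Set ℝ} (hB : MeasurableSet B) :
    μ.withDensity (fun v => h ‖v‖) A * μ.withDensity (fun v => k ‖v‖) {v | ‖v‖ ∈ B} =
      μ.withDensity (fun v => k ‖v‖) (A ∩ {v | ‖v‖ ∈ B}) := by
  have h1 := withDensity_norm_cone_inter μ hh hA hcone MeasurableSet.univ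
  have h2 := withDensity_norm_cone_inter μ hk MeasurableSet.univ (fun _ _ _ _ => trivial) hB
  have h3 := withDensity_norm_cone_inter μ hh MeasurableSet.univ (fun _ _ _ _ => trivial)
    MeasurableSet.univ
  rw [withDensity_norm_cone_inter μ hk hA hcone hB]
  simp only [mem_univ, ofPred_true, inter_univ, univ_inter, preimage_univ, measure_univ] at h1 h2 h3
  rw [h1, h2, mul_assoc, ← mul_assoc _ (μ.toSphere univ), mul_comm _ (μ.toSphere univ), ← h3,
    one_mul]

end Polar

theorem IsEllipticalLaw.exists_norm_density {d : ℕ} {ν : Measure (EuclideanSpace ℝ (Fin d))}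
    (hν : IsEllipticalLaw 0 1 ν) :
    ∃ h : ℝ → ENNReal, Measurable h ∧ ν = volume.withDensity fun v => h ‖v‖ := by
  obtain ⟨-, -, g, hg, -, c, -, rfl⟩ := hν
  refine ⟨fun r => ENNReal.ofReal (c * g (r ^ 2)), ?_, ?_⟩
  · have : Continuous fun r : ℝ => g (r ^ 2) :=
      hg.comp_continuous (by fun_prop) fun r => Set.mem_Ici.2 (sq_nonneg r)
    exact (this.measurable.const_mul c).ennreal_ofReal
  · congr 1
    ext v
    have : v.ofLp ⬝ᵥ v.ofLp = ‖v‖ ^ 2 := by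
      rw [EuclideanSpace.real_norm_sq_eq, dotProduct]
      simp [sq]
    simp [this]

theorem isEllipticalLaw_stdGaussian (d : ℕ) :
    IsEllipticalLaw 0 1 (stdGaussian (EuclideanSpace ℝ (Fin d))) := by
  refine ⟨inferInstance, Matrix.PosDef.one, fun t => Real.exp (-(1 / 2) * t), by fun_prop,
    fun t _ => (Real.exp_pos _).le,
    (1 / (2 * Real.pi)) ^ (Module.finrank ℝ (EuclideanSpace ℝ (Fin d)) / 2 : ℝ), by positivity, ?_⟩
  rw [stdGaussian_eq_withDensity]
  congr 1
  ext v
  have : v.ofLp ⬝ᵥ v.ofLp = ‖v‖ ^ 2 := by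
    rw [EuclideanSpace.real_norm_sq_eq, dotProduct]
    simp [sq]
  simp [this]

/-- Any cone has the same mass under all spherical laws, and is independent of the norm. -/
theorem IsEllipticalLaw.cone_mul_stdGaussian {d : ℕ} (hd : d ≠ 0)
    {ν : Measure (EuclideanSpace ℝ (Fin d))} (hν : IsEllipticalLaw 0 1 ν)
    {A : Set (EuclideanSpace ℝ (Fin d))} (hA : MeasurableSet A)
    (hcone : ∀ (c : ℝ) x, 0 < c → x ∈ A → c • x ∈ A) {B : Set ℝ} (hB : MeasurableSet B) :
    ν.real A * (stdGaussian (EuclideanSpace ℝ (Fin d))).real {v | ‖v‖ ∈ B} =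
      (stdGaussian (EuclideanSpace ℝ (Fin d))).real (A ∩ {v | ‖v‖ ∈ B}) := by
  have : NeZero d := ⟨hd⟩
  have h1 := hν.1
  have h2 := (isEllipticalLaw_stdGaussian d).1
  obtain ⟨h, hh, rfl⟩ := hν.exists_norm_density
  obtain ⟨k, hk, hkν⟩ := (isEllipticalLaw_stdGaussian d).exists_norm_density
  rw [hkν] at h2 ⊢
  simp only [measureReal_def, ← ENNReal.toReal_mul]
  rw [withDensity_norm_cone_mul volume hh hk hA hcone hB]

/-! ### Gram factorisation of degenerate Gaussian vectors -/

theorem Matrix.PosSemidef.exists_transpose_mul_self {p d : ℕ} {S : Matrix (Fin p) (Fin p) ℝ}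
    (hS : S.PosSemidef) (hd : S.rank = d) : ∃ L : Matrix (Fin d) (Fin p) ℝ, Lᵀ * L = S := by
  obtain ⟨B, rfl⟩ : ∃ B : Matrix (Fin p) (Fin p) ℝ, S = Bᴴ * B := by
    open scoped MatrixOrder in
    exact CStarAlgebra.nonneg_iff_eq_star_mul_self.1 hS.nonneg
  rw [rank_conjTranspose_mul_self] at hd
  let f := Matrix.toEuclideanLin B
  have hf : Module.finrank ℝ (LinearMap.range f) = d := by
    rw [← hd]
    exact (Matrix.rank_eq_finrank_range_toLin B (EuclideanSpace.basisFun (Fin p) ℝ).toBasis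
      (EuclideanSpace.basisFun (Fin p) ℝ).toBasis).symm
  let e := (stdOrthonormalBasis ℝ (LinearMap.range f)).reindex (finCongr hf)
  let w : Fin p → LinearMap.range f := fun j => ⟨f (EuclideanSpace.single j 1), ⟨_, rfl⟩⟩
  refine ⟨Matrix.of fun i j => inner ℝ (e i) (w j), ?_⟩
  refine Matrix.ext fun j k => ?_
  have h := e.sum_inner_mul_inner (w j) (w k)
  have h2 : ∀ j, f (EuclideanSpace.single j 1) = WithLp.toLp 2 (B.col j) := by
    intro j
    simp [f, Matrix.toLpLin_apply]
  calc ∑ i, inner ℝ (e i) (w j) * inner ℝ (e i) (w k)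
      = inner ℝ (w j) (w k) := by simp_rw [← h, real_inner_comm (e _) (w j)]
    _ = inner ℝ (WithLp.toLp 2 (B.col j)) (WithLp.toLp 2 (B.col k)) := by
        rw [Submodule.coe_inner, ← h2, ← h2]
    _ = (Bᴴ * B) j k := by
        simp [EuclideanSpace.inner_eq_star_dotProduct, Matrix.mul_apply, dotProduct, mul_comm]

theorem multivariateGaussian_eq_map_stdGaussian {p d : ℕ} {S : Matrix (Fin p) (Fin p) ℝ}
    (hS : S.PosSemidef) {L : Matrix (Fin d) (Fin p) ℝ} (hL : Lᵀ * L = S) :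
    multivariateGaussian 0 S =
      (stdGaussian (EuclideanSpace ℝ (Fin d))).map fun z => WithLp.toLp 2 (Lᵀ *ᵥ z.ofLp) := by
  have hm : Measurable fun z : EuclideanSpace ℝ (Fin d) => WithLp.toLp 2 (Lᵀ *ᵥ z.ofLp) := by
    fun_prop
  have := Measure.isProbabilityMeasure_map (μ := stdGaussian (EuclideanSpace ℝ (Fin d)))
    hm.aemeasurable
  refine Measure.ext_of_charFun (funext fun t => ?_)
  rw [charFun_multivariateGaussian hS, charFun_apply, integral_map hm.aemeasurable (by fun_prop)]
  have h1 : ∀ z : EuclideanSpace ℝ (Fin d), inner ℝ (WithLp.toLp 2 (Lᵀ *ᵥ z.ofLp)) t =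
      inner ℝ z (WithLp.toLp 2 (L *ᵥ t.ofLp)) := by
    intro z
    simp only [EuclideanSpace.inner_eq_star_dotProduct, star_trivial, mulVec_transpose]
    rw [dotProduct_comm, ← dotProduct_mulVec, dotProduct_comm]
  simp_rw [h1]
  rw [← charFun_apply, charFun_stdGaussian, ← hL, ← mulVec_mulVec, dotProduct_mulVec,
    vecMul_transpose, ← Complex.ofReal_pow, EuclideanSpace.real_norm_sq_eq]
  simp [dotProduct, sq, neg_div]

theorem IsCorrelationMatrix.isEllipticalVector_stdGaussian {p d : ℕ}
    {S : Matrix (Fin p) (Fin p) ℝ} (hS : IsCorrelationMatrix S) (hd : S.rank = d)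
    {Ω : Type*} [MeasurableSpace Ω] {P : Measure Ω} {X : Ω → EuclideanSpace ℝ (Fin p)}
    (hX : HasLaw X (multivariateGaussian 0 S) P) :
    IsEllipticalVector (stdGaussian (EuclideanSpace ℝ (Fin d))) S X P := by
  obtain ⟨L, hL⟩ := hS.1.exists_transpose_mul_self hd
  exact ⟨hd, L, hL, multivariateGaussian_eq_map_stdGaussian hS.1 hL ▸ hX⟩

/-! ### Reduction of the maximum norm to a union of half-spaces -/

theorem measurable_maxNorm {p : ℕ} : Measurable (maxNorm (p := p)) := by
  unfold maxNorm
  exact Measurable.iSup fun j => by fun_prop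

theorem lt_maxNorm_iff {p : ℕ} (hp : p ≠ 0) {x : EuclideanSpace ℝ (Fin p)} {a : ℝ} :
    a < maxNorm x ↔ ∃ j, a < |x j| := by
  have : NeZero p := ⟨hp⟩
  exact lt_ciSup_iff (Set.finite_range _).bddAbove

theorem IsEllipticalVector.exists_unit_vectors {p d : ℕ} (hp : p ≠ 0) {Ω : Type*}
    [MeasurableSpace Ω] {ν : Measure (EuclideanSpace ℝ (Fin d))} {S : Matrix (Fin p) (Fin p) ℝ}
    {X : Ω → EuclideanSpace ℝ (Fin p)} {P : Measure Ω} (hX : IsEllipticalVector ν S X P)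
    (hS : IsCorrelationMatrix S) :
    ∃ l : Fin p → EuclideanSpace ℝ (Fin d), (∀ j, ‖l j‖ = 1) ∧
      ∀ a : ℝ, P.real {ω | a < maxNorm (X ω)} = ν.real {z | ∃ j, a < |inner ℝ (l j) z|} := by
  obtain ⟨-, L, hL, hlaw⟩ := hX
  refine ⟨fun j => WithLp.toLp 2 (L.col j), fun j => ?_, fun a => ?_⟩
  · have h := hS.2 j
    rw [← hL, Matrix.mul_apply] at h
    rw [← sq_eq_sq₀ (norm_nonneg _) zero_le_one, EuclideanSpace.real_norm_sq_eq, one_pow, ← h]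
    simp [sq]
  · rw [hlaw.measureReal_eq (p := fun x => a < maxNorm x)
      (measurableSet_lt measurable_const measurable_maxNorm),
      map_measureReal_apply (by fun_prop) (measurableSet_lt measurable_const measurable_maxNorm)]
    congr 1
    ext z
    simp only [Set.mem_preimage, Set.mem_ofPred_eq, lt_maxNorm_iff hp]
    simp [EuclideanSpace.inner_eq_star_dotProduct, mulVec, dotProduct_comm]
    exact Iff.rfl

/-! ### The bound `1 - p ^ (-2 / (d - 1))` -/

section Rate

variable {p d : ℕ}

theorem one_lt_natCast_rpow (hp : 2 ≤ p) (hd : 2 ≤ d) : 1 < (p : ℝ) ^ (2 / ((d : ℝ) - 1)) := by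
  have h1 : (2 : ℝ) ≤ p := by exact_mod_cast hp
  have h2 : (2 : ℝ) ≤ d := by exact_mod_cast hd
  exact Real.one_lt_rpow (by linarith) (div_pos two_pos (by linarith))

theorem rexBound_eq (u : ℝ) (p d : ℕ) :
    rexBound u p d = √(u * (1 - ((p : ℝ) ^ (2 / ((d : ℝ) - 1)))⁻¹)) := by
  rw [rexBound, neg_div, Real.rpow_neg p.cast_nonneg]

theorem natCast_mul_rpow_neg_le_one (hp : 2 ≤ p) (hd : 2 ≤ d) :
    (p : ℝ) * ((p : ℝ) ^ (2 / ((d : ℝ) - 1))) ^ (-((d : ℝ) / 2)) ≤ 1 := by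
  have h1 : (2 : ℝ) ≤ p := by exact_mod_cast hp
  have h2 : (2 : ℝ) ≤ d := by exact_mod_cast hd
  have h3 : (0 : ℝ) < d - 1 := by linarith
  rw [← Real.rpow_mul (by linarith), mul_comm, ← Real.rpow_add_one (by linarith)]
  refine Real.rpow_le_one_of_one_le_of_nonpos (by linarith) ?_
  have : 2 / ((d : ℝ) - 1) * -(d / 2) + 1 = -1 / (d - 1) := by field_simp; ring
  rw [this]
  exact div_nonpos_of_nonpos_of_nonneg (by norm_num) h3.le

theorem two_mul_log_le_mul_rpow_sub_one (hp : 2 ≤ p) (hd : 2 ≤ d) :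
    2 * Real.log p ≤ d * ((p : ℝ) ^ (2 / ((d : ℝ) - 1)) - 1) := by
  have h1 : (2 : ℝ) ≤ p := by exact_mod_cast hp
  have h2 : (2 : ℝ) ≤ d := by exact_mod_cast hd
  have h3 : (0 : ℝ) < d - 1 := by linarith
  have hl : 0 ≤ Real.log p := Real.log_nonneg (by linarith)
  have h4 : Real.log p * (2 / (d - 1)) ≤ (p : ℝ) ^ (2 / ((d : ℝ) - 1)) - 1 := by
    rw [Real.rpow_def_of_pos (by linarith)]
    linarith [Real.add_one_le_exp (Real.log p * (2 / ((d : ℝ) - 1)))]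
  have h5 : 2 * Real.log p = (d - 1) * (Real.log p * (2 / (d - 1))) := by field_simp
  have h6 : 0 ≤ Real.log p * (2 / ((d : ℝ) - 1)) := by positivity
  nlinarith

theorem mul_rpow_sub_one_le (hp : 2 ≤ p) (hd : 2 ≤ d) (hpd : 2 * Real.log p + 1 ≤ d) :
    d * ((p : ℝ) ^ (2 / ((d : ℝ) - 1)) - 1) ≤ 8 * Real.log p := by
  have h1 : (2 : ℝ) ≤ p := by exact_mod_cast hp
  have h2 : (2 : ℝ) ≤ d := by exact_mod_cast hd
  have h3 : (0 : ℝ) < d - 1 := by linarith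
  have hl : 0 ≤ Real.log p := Real.log_nonneg (by linarith)
  have h6 : 0 ≤ Real.log p * (2 / ((d : ℝ) - 1)) := by positivity
  have h4 := Real.abs_exp_sub_one_le (x := Real.log p * (2 / (d - 1))) (by
    rw [abs_of_nonneg h6, mul_div_assoc', div_le_one h3]; linarith)
  rw [abs_of_nonneg h6] at h4
  rw [Real.rpow_def_of_pos (by linarith)]
  have h5 : 2 * Real.log p = (d - 1) * (Real.log p * (2 / (d - 1))) := by field_simp
  nlinarith [le_abs_self (Real.exp (Real.log p * (2 / ((d : ℝ) - 1))) - 1)]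

theorem natCast_mul_stdGaussian_abs_inner_gt_norm_le (hp : 2 ≤ p) (hd : 2 ≤ d)
    {l : EuclideanSpace ℝ (Fin d)} (hl : ‖l‖ = 1) {b D q : ℝ} (hb : 0 < b)
    (hq : q = (p : ℝ) ^ (2 / ((d : ℝ) - 1))) :
    p * (stdGaussian (EuclideanSpace ℝ (Fin d))).real {z | b < |inner ℝ l z| ∧ ‖z‖ ^ 2 ≤ D} ≤
      Real.exp ((q - 1) / 2 * D - b ^ 2 * q / 2) / √(b ^ 2 * q) := by
  have hq1 : 1 < q := hq ▸ one_lt_natCast_rpow hp hd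
  have h := stdGaussian_abs_inner_gt_norm_le hl (D := D) hq1.le hb
  rw [finrank_euclideanSpace_fin] at h
  have h2 : (p : ℝ) * q ^ (-((d : ℝ) / 2)) ≤ 1 := hq ▸ natCast_mul_rpow_neg_le_one hp hd
  have h3 : √(b ^ 2 * q) = b * √q := by
    rw [Real.sqrt_mul (sq_nonneg b), Real.sqrt_sq hb.le]
  have h4 : (b * √q) ^ 2 = b ^ 2 * q := by rw [mul_pow, Real.sq_sqrt (by linarith)]
  calc _ ≤ (p : ℝ) * (Real.exp ((q - 1) / 2 * D) * q ^ (-((d : ℝ) / 2)) *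
        (Real.exp (-(b * √q) ^ 2 / 2) / (b * √q))) := by gcongr
    _ = (p * q ^ (-((d : ℝ) / 2))) * (Real.exp ((q - 1) / 2 * D) *
        Real.exp (-(b * √q) ^ 2 / 2) / (b * √q)) := by ring
    _ ≤ 1 * (Real.exp ((q - 1) / 2 * D) * Real.exp (-(b * √q) ^ 2 / 2) / (b * √q)) := by
        gcongr
    _ = _ := by rw [one_mul, ← Real.exp_add, h4, h3, neg_div, ← sub_eq_add_neg]

end Rate

/-! ### Spherical caps and the elliptical bound -/

theorem IsEllipticalLaw.natCast_mul_cone_le {p d : ℕ} (hp : 2 ≤ p) (hd : 2 ≤ d)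
    {ν : Measure (EuclideanSpace ℝ (Fin d))} (hν : IsEllipticalLaw 0 1 ν)
    {l : EuclideanSpace ℝ (Fin d)} (hl : ‖l‖ = 1) {δ : ℝ} (hδ : 0 < δ) (hlog : 1 ≤ Real.log p)
    (hdδ : Real.exp (-(d * (δ / (2 * (2 + δ))) ^ 2 / 8)) ≤ 1 / 4) :
    p * ν.real {z | (1 + δ) * (1 - ((p : ℝ) ^ (2 / ((d : ℝ) - 1)))⁻¹) * ‖z‖ ^ 2
      < (inner ℝ l z) ^ 2} ≤ 2 * Real.exp (-(δ * Real.log p / 2)) := by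
  obtain ⟨q, hq⟩ : ∃ q, q = (p : ℝ) ^ (2 / ((d : ℝ) - 1)) := ⟨_, rfl⟩
  rw [← hq]
  have hq1 : 1 < q := hq ▸ one_lt_natCast_rpow hp hd
  have hdq : 2 * Real.log p ≤ d * (q - 1) := hq ▸ two_mul_log_le_mul_rpow_sub_one hp hd
  have hd0 : (0 : ℝ) < d := by exact_mod_cast (by lia : 0 < d)
  have hqinv : 0 < 1 - q⁻¹ := sub_pos.2 (inv_lt_one_of_one_lt₀ hq1)
  set t := δ / (2 * (2 + δ)) with ht
  have ht0 : 0 < t := by positivity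
  have ht1 : t ≤ 1 / 2 := by rw [ht, div_le_iff₀ (by positivity)]; linarith
  set A := {z : EuclideanSpace ℝ (Fin d) | (1 + δ) * (1 - q⁻¹) * ‖z‖ ^ 2 < (inner ℝ l z) ^ 2}
    with hAdef
  have hA : MeasurableSet A := measurableSet_lt (by fun_prop) (by fun_prop)
  have hcone : ∀ (c : ℝ) z, 0 < c → z ∈ A → c • z ∈ A := by
    intro c z hc hz
    have hz : (1 + δ) * (1 - q⁻¹) * ‖z‖ ^ 2 < (inner ℝ l z) ^ 2 := hz
    rw [hAdef, Set.mem_ofPred_eq, inner_smul_right, norm_smul, mul_pow, mul_pow, Real.norm_eq_abs,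
      sq_abs]
    nlinarith [mul_lt_mul_of_pos_left hz (pow_pos hc 2)]
  set B : Set ℝ := {r | d * (1 - t) < r ^ 2 ∧ r ^ 2 < d * (1 + t)}
  have hB : MeasurableSet B := MeasurableSet.inter (s₁ := {r : ℝ | d * (1 - t) < r ^ 2})
      (s₂ := {r : ℝ | r ^ 2 < d * (1 + t)}) (measurableSet_lt (by fun_prop) (by fun_prop))
      (measurableSet_lt (by fun_prop) (by fun_prop))
  have hGB : 1 / 2 ≤ (stdGaussian (EuclideanSpace ℝ (Fin d))).real {v | ‖v‖ ∈ B} := by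
    have h1 := stdGaussian_norm_sq_gt_le (E := EuclideanSpace ℝ (Fin d)) ht0.le ht1
    have h2 := stdGaussian_norm_sq_lt_le (E := EuclideanSpace ℝ (Fin d)) ht0.le ht1
    rw [finrank_euclideanSpace_fin] at h1 h2
    have h3 : ({v | ‖v‖ ∈ B}ᶜ : Set (EuclideanSpace ℝ (Fin d))) ⊆
        {z | d * (1 + t) ≤ ‖z‖ ^ 2} ∪ {z | ‖z‖ ^ 2 ≤ d * (1 - t)} := by
      intro z hz
      by_contra h
      simp only [Set.mem_union, Set.mem_ofPred_eq, not_or, not_le] at h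
      exact hz ⟨h.2, h.1⟩
    have h4 := (measureReal_mono h3 (μ := stdGaussian (EuclideanSpace ℝ (Fin d)))).trans
      (measureReal_union_le _ _)
    rw [probReal_compl_eq_one_sub (s := {v | ‖v‖ ∈ B}) (measurable_norm hB)] at h4
    linarith
  have hmul := hν.cone_mul_stdGaussian (by lia) hA hcone hB
  set b := √((1 + δ) * (1 - q⁻¹) * (d * (1 - t)))
  have hb : 0 < b := Real.sqrt_pos.2 (by have : 0 < 1 - t := by linarith
                                         positivity)
  have hbsq : b ^ 2 * q = (1 + δ) * (1 - t) * (d * (q - 1)) := by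
    rw [Real.sq_sqrt (Real.sqrt_pos.1 hb).le]
    field_simp
  have hsub : A ∩ {v | ‖v‖ ∈ B} ⊆ {z | b < |inner ℝ l z| ∧ ‖z‖ ^ 2 ≤ d * (1 + t)} := by
    rintro z ⟨hzA, hzB⟩
    refine ⟨?_, hzB.2.le⟩
    rw [← Real.sqrt_sq_eq_abs]
    refine Real.sqrt_lt_sqrt (Real.sqrt_pos.1 hb).le (lt_of_le_of_lt ?_ hzA)
    have := hzB.1.le
    gcongr
  have hG := natCast_mul_stdGaussian_abs_inner_gt_norm_le hp hd hl (D := d * (1 + t)) hb hq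
  have hmono := measureReal_mono hsub (μ := stdGaussian (EuclideanSpace ℝ (Fin d)))
  have hexp : (q - 1) / 2 * (d * (1 + t)) - b ^ 2 * q / 2 ≤ -(δ * Real.log p / 2) := by
    have h1 : (1 + t) - (1 + δ) * (1 - t) = -(δ / 2) := by rw [ht]; field_simp; ring
    have h2 : (q - 1) / 2 * (d * (1 + t)) - b ^ 2 * q / 2 =
        ((1 + t) - (1 + δ) * (1 - t)) * (d * (q - 1)) / 2 := by rw [hbsq]; ring
    rw [h2, h1]
    nlinarith
  have hden : 1 ≤ √(b ^ 2 * q) := by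
    rw [Real.one_le_sqrt, hbsq]
    have : 1 / 2 ≤ (1 + δ) * (1 - t) := by nlinarith
    nlinarith
  have hnum : Real.exp ((q - 1) / 2 * (d * (1 + t)) - b ^ 2 * q / 2) / √(b ^ 2 * q) ≤
      Real.exp (-(δ * Real.log p / 2)) :=
    (div_le_self (Real.exp_pos _).le hden).trans (Real.exp_le_exp.2 hexp)
  have h0 : 0 ≤ ν.real A := measureReal_nonneg
  have hνA : ν.real A ≤ 2 * (stdGaussian (EuclideanSpace ℝ (Fin d))).real
      {z | b < |inner ℝ l z| ∧ ‖z‖ ^ 2 ≤ d * (1 + t)} := by nlinarith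
  have := mul_le_mul_of_nonneg_left hνA (Nat.cast_nonneg (α := ℝ) p)
  linarith

theorem tendsto_exp_neg_mul_natCast {c : ℝ} (hc : 0 < c) :
    Tendsto (fun n : ℕ => Real.exp (-(n * c))) atTop (𝓝 0) :=
  Real.tendsto_exp_neg_atTop_nhds_zero.comp
    (tendsto_natCast_atTop_atTop.atTop_mul_const hc)

theorem tendsto_log_natCast : Tendsto (fun n : ℕ => Real.log n) atTop atTop :=
  Real.tendsto_log_atTop.comp tendsto_natCast_atTop_atTop

theorem rexBound_pos {u : ℝ} (hu : 0 < u) {p d : ℕ} (hp : 2 ≤ p) (hd : 2 ≤ d) :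
    0 < rexBound u p d := by
  rw [rexBound_eq]
  exact Real.sqrt_pos.2 (mul_pos hu (sub_pos.2 (inv_lt_one_of_one_lt₀ (one_lt_natCast_rpow hp hd))))

theorem elliptical_rex_bound (ν : (d : ℕ) → Measure (EuclideanSpace ℝ (Fin d))) (u : ℕ → ℝ)
    (hν : ∀ d, IsEllipticalLaw 0 1 (ν d))
    (hu : ∀ η : ℝ, 0 < η →
      Tendsto (fun d => (ν d).real {z | η < |‖z‖ ^ 2 / u d - 1|}) atTop (𝓝 0))
    {δ : ℝ} (hδ : 0 < δ) {ε : ℝ} (hε : 0 < ε) :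
    ∃ N : ℕ, ∀ p d : ℕ, N ≤ p → N ≤ d →
      ∀ S : Matrix (Fin p) (Fin p) ℝ, IsCorrelationMatrix S →
      ∀ (Ω : Type*) [MeasurableSpace Ω] (P : Measure Ω) [IsProbabilityMeasure P]
        (X : Ω → EuclideanSpace ℝ (Fin p)), IsEllipticalVector (ν d) S X P →
        P.real {ω | maxNorm (X ω) / rexBound (u d) p d > 1 + δ} < ε := by
  have hpos : ∀ᶠ d in atTop, 0 < u d := by
    filter_upwards [(hu (1 / 2) (by norm_num)).eventually_lt_const one_pos] with d hd
    by_contra! h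
    have := (hν d).1
    have huniv : {z : EuclideanSpace ℝ (Fin d) | (1 / 2 : ℝ) < |‖z‖ ^ 2 / u d - 1|} = Set.univ := by
      refine Set.eq_univ_of_forall fun z => ?_
      have : ‖z‖ ^ 2 / u d ≤ 0 := div_nonpos_of_nonneg_of_nonpos (sq_nonneg _) h
      rw [Set.mem_ofPred_eq, abs_of_nonpos (by linarith)]
      linarith
    rw [huniv] at hd
    simp at hd
  have hdδ : ∀ᶠ d : ℕ in atTop, Real.exp (-(d * (δ / (2 * (2 + δ))) ^ 2 / 8)) < 1 / 4 := by
    have := tendsto_exp_neg_mul_natCast (c := (δ / (2 * (2 + δ))) ^ 2 / 8) (by positivity)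
    simp_rw [← mul_div_assoc] at this
    exact this.eventually_lt_const (by norm_num)
  have hpδ : ∀ᶠ p : ℕ in atTop, Real.exp (-(δ * Real.log p / 2)) < ε / 4 := by
    refine (Real.tendsto_exp_neg_atTop_nhds_zero.comp
      ((tendsto_log_natCast.const_mul_atTop hδ).atTop_div_const two_pos)).eventually_lt_const ?_
    positivity
  obtain ⟨N₁, h₁⟩ := eventually_atTop.1 (hpos.and (hdδ.and ((eventually_ge_atTop 2).and
    ((hu δ hδ).eventually_lt_const (half_pos hε)))))
  obtain ⟨N₂, h₂⟩ := eventually_atTop.1 (hpδ.and ((eventually_ge_atTop 2).and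
    (tendsto_log_natCast.eventually_ge_atTop 1)))
  refine ⟨max N₁ N₂, fun p d hp hd S hS Ω _ P _ X hX => ?_⟩
  obtain ⟨hud, hdδ, hd2, hconc⟩ := h₁ d (le_of_max_le_left hd)
  obtain ⟨hpδ, hp2, hlog⟩ := h₂ p (le_of_max_le_right hp)
  have := (hν d).1
  obtain ⟨l, hl, hPl⟩ := hX.exists_unit_vectors (by lia) hS
  simp only [gt_iff_lt, lt_div_iff₀ (rexBound_pos hud hp2 hd2)]
  rw [hPl, rexBound_eq]
  set q := (p : ℝ) ^ (2 / ((d : ℝ) - 1)) with hq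
  have hqinv : 0 < 1 - q⁻¹ := sub_pos.2 (inv_lt_one_of_one_lt₀ (one_lt_natCast_rpow hp2 hd2))
  have hsub : {z : EuclideanSpace ℝ (Fin d) | ∃ j, (1 + δ) * √(u d * (1 - q⁻¹)) < |inner ℝ (l j) z|} ⊆
      {z | δ < |‖z‖ ^ 2 / u d - 1|} ∪
        ⋃ j, {z | (1 + δ) * (1 - q⁻¹) * ‖z‖ ^ 2 < (inner ℝ (l j) z) ^ 2} := by
    rintro z ⟨j, hj⟩
    by_cases hz : δ < |‖z‖ ^ 2 / u d - 1|
    · exact Or.inl hz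
    refine Or.inr (Set.mem_iUnion.2 ⟨j, ?_⟩)
    have hz1 : ‖z‖ ^ 2 ≤ (1 + δ) * u d := by
      rw [← div_le_iff₀ hud]
      linarith [le_abs_self (‖z‖ ^ 2 / u d - 1)]
    have hj2 := pow_lt_pow_left₀ hj (by positivity) two_ne_zero
    rw [sq_abs, mul_pow, Real.sq_sqrt (by positivity)] at hj2
    refine lt_of_le_of_lt ?_ hj2
    calc (1 + δ) * (1 - q⁻¹) * ‖z‖ ^ 2 ≤ (1 + δ) * (1 - q⁻¹) * ((1 + δ) * u d) := by gcongr
      _ = _ := by ring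
  have hsum : (ν d).real (⋃ j, {z | (1 + δ) * (1 - q⁻¹) * ‖z‖ ^ 2 < (inner ℝ (l j) z) ^ 2}) ≤
      2 * Real.exp (-(δ * Real.log p / 2)) := by
    have hp0 : (0 : ℝ) < p := by exact_mod_cast (by lia : 0 < p)
    refine (measureReal_iUnion_fintype_le _).trans ?_
    calc _ ≤ ∑ _j : Fin p, 2 * Real.exp (-(δ * Real.log p / 2)) / p := by
          refine Finset.sum_le_sum fun j _ => ?_
          rw [le_div_iff₀' hp0]
          exact (hν d).natCast_mul_cone_le hp2 hd2 (hl j) hδ hlog hdδ.le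
      _ = _ := by
          rw [Finset.sum_const, Finset.card_univ, Fintype.card_fin, nsmul_eq_mul]
          field_simp
  have := (measureReal_mono hsub (μ := ν d)).trans (measureReal_union_le _ _)
  linarith

theorem tendsto_stdGaussian_norm_sq_div {η : ℝ} (hη : 0 < η) :
    Tendsto (fun d : ℕ => (stdGaussian (EuclideanSpace ℝ (Fin d))).real
      {z | η < |‖z‖ ^ 2 / d - 1|}) atTop (𝓝 0) := by
  set t := min η (1 / 2)
  have ht : 0 < t := lt_min hη (by norm_num)
  have h := (tendsto_exp_neg_mul_natCast (c := t ^ 2 / 8) (by positivity)).const_mul 2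
  rw [mul_zero] at h
  refine squeeze_zero' (Eventually.of_forall fun _ => measureReal_nonneg) ?_ h
  filter_upwards [eventually_gt_atTop 0] with d hd
  have hd0 : (0 : ℝ) < d := by exact_mod_cast hd
  have h1 := stdGaussian_norm_sq_gt_le (E := EuclideanSpace ℝ (Fin d)) ht.le (min_le_right _ _)
  have h2 := stdGaussian_norm_sq_lt_le (E := EuclideanSpace ℝ (Fin d)) ht.le (min_le_right _ _)
  rw [finrank_euclideanSpace_fin, mul_div_assoc] at h1 h2
  have h3 : {z : EuclideanSpace ℝ (Fin d) | η < |‖z‖ ^ 2 / d - 1|} ⊆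
      {z | d * (1 + t) ≤ ‖z‖ ^ 2} ∪ {z | ‖z‖ ^ 2 ≤ d * (1 - t)} := by
    intro z hz
    have hz : t < |‖z‖ ^ 2 / d - 1| := (min_le_left _ _).trans_lt hz
    rcases lt_abs.1 hz with hz | hz
    · left
      rw [Set.mem_ofPred_eq, ← le_div_iff₀' hd0]
      linarith
    · right
      rw [Set.mem_ofPred_eq, ← div_le_iff₀' hd0]
      linarith
  have h4 := (measureReal_mono h3 (μ := stdGaussian (EuclideanSpace ℝ (Fin d)))).trans
    (measureReal_union_le _ _)
  linarith

/-! ### Gaussian vectors of high rank -/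

theorem stdGaussian_exists_abs_inner_gt_le {p d : ℕ} (hp : 2 ≤ p) (hd : 2 ≤ d)
    (hpd : 2 * Real.log p + 1 ≤ d) (hlog : 1 ≤ Real.log p)
    {l : Fin p → EuclideanSpace ℝ (Fin d)} (hl : ∀ j, ‖l j‖ = 1) :
    (stdGaussian (EuclideanSpace ℝ (Fin d))).real {z | ∃ j, rexBound d p d < |inner ℝ (l j) z|} ≤
      Real.exp (-(Real.log (Real.log p) ^ 2 * d / Real.log p ^ 2 / 2048)) +
        Real.exp (-(Real.log (Real.log p) / 4)) := by
  obtain ⟨q, hq⟩ : ∃ q, q = (p : ℝ) ^ (2 / ((d : ℝ) - 1)) := ⟨_, rfl⟩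
  have hq1 : 1 < q := hq ▸ one_lt_natCast_rpow hp hd
  have hdq : 2 * Real.log p ≤ d * (q - 1) := hq ▸ two_mul_log_le_mul_rpow_sub_one hp hd
  have hdq' : d * (q - 1) ≤ 8 * Real.log p := hq ▸ mul_rpow_sub_one_le hp hd hpd
  have hd0 : (0 : ℝ) < d := by exact_mod_cast (by lia : 0 < d)
  have hp0 : (0 : ℝ) < p := by exact_mod_cast (by lia : 0 < p)
  set ℓ := Real.log p
  have hℓ : 0 < ℓ := one_pos.trans_le hlog
  have hlogℓ : 0 ≤ Real.log ℓ := Real.log_nonneg hlog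
  have hb := rexBound_pos hd0 hp hd
  have hbq : rexBound d p d ^ 2 * q = d * (q - 1) := by
    rw [rexBound_eq, ← hq, Real.sq_sqrt (by
      have := sub_pos.2 (inv_lt_one_of_one_lt₀ hq1); positivity)]
    field_simp
  set b := rexBound d p d
  set t := Real.log ℓ / (16 * ℓ) with ht
  have ht0 : 0 ≤ t := by positivity
  have ht1 : t ≤ 1 / 2 := by
    rw [ht, div_le_iff₀ (by positivity)]
    linarith [Real.log_le_self hℓ.le]
  have hsub : {z : EuclideanSpace ℝ (Fin d) | ∃ j, b < |inner ℝ (l j) z|} ⊆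
      {z | d * (1 + t) ≤ ‖z‖ ^ 2} ∪
        ⋃ j, {z | b < |inner ℝ (l j) z| ∧ ‖z‖ ^ 2 ≤ d * (1 + t)} := by
    rintro z ⟨j, hj⟩
    rcases le_total (d * (1 + t)) (‖z‖ ^ 2) with h | h
    · exact Or.inl h
    · exact Or.inr (Set.mem_iUnion.2 ⟨j, hj, h⟩)
  have hconc := stdGaussian_norm_sq_gt_le (E := EuclideanSpace ℝ (Fin d)) ht0 ht1
  have htsq : (d : ℝ) * t ^ 2 / 8 = Real.log ℓ ^ 2 * d / ℓ ^ 2 / 2048 := by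
    rw [ht]; field_simp; ring
  rw [finrank_euclideanSpace_fin, htsq] at hconc
  have hbound : Real.exp ((q - 1) / 2 * (d * (1 + t)) - b ^ 2 * q / 2) / √(b ^ 2 * q) ≤
      Real.exp (-(Real.log ℓ / 4)) := by
    have h1 : (q - 1) / 2 * (d * (1 + t)) - b ^ 2 * q / 2 ≤ Real.log ℓ / 4 := by
      have h2 : t * ℓ = Real.log ℓ / 16 := by rw [ht]; field_simp
      rw [hbq]
      nlinarith [mul_le_mul_of_nonneg_left hdq' ht0]
    have h3 : Real.exp (Real.log ℓ / 2) ≤ √(b ^ 2 * q) := by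
      rw [hbq]
      refine Real.le_sqrt_of_sq_le ?_
      rw [← Real.exp_nat_mul, Nat.cast_ofNat, mul_div_cancel₀ _ two_ne_zero, Real.exp_log hℓ]
      linarith
    calc _ ≤ Real.exp (Real.log ℓ / 4) / Real.exp (Real.log ℓ / 2) := by gcongr
      _ = _ := by rw [← Real.exp_sub]; congr 1; ring
  have hsum : (stdGaussian (EuclideanSpace ℝ (Fin d))).real
      (⋃ j, {z | b < |inner ℝ (l j) z| ∧ ‖z‖ ^ 2 ≤ d * (1 + t)}) ≤
      Real.exp (-(Real.log ℓ / 4)) := by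
    refine (measureReal_iUnion_fintype_le _).trans ?_
    calc _ ≤ ∑ _j : Fin p, Real.exp (-(Real.log ℓ / 4)) / p := by
          refine Finset.sum_le_sum fun j _ => ?_
          rw [le_div_iff₀' hp0]
          exact (natCast_mul_stdGaussian_abs_inner_gt_norm_le hp hd (hl j) hb hq).trans hbound
      _ = _ := by
          rw [Finset.sum_const, Finset.card_univ, Fintype.card_fin, nsmul_eq_mul]
          field_simp
  exact (measureReal_mono hsub).trans ((measureReal_union_le _ _).trans (add_le_add hconc hsum))

theorem gaussian_rex_bound_high_rank (d : ℕ → ℕ)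
    (hd : Tendsto (fun p : ℕ => (Real.log (Real.log p)) ^ 2 * (d p : ℝ) / (Real.log p) ^ 2)
      atTop atTop) {ε : ℝ} (hε : 0 < ε) :
    ∃ N : ℕ, ∀ p : ℕ, N ≤ p →
      ∀ S : Matrix (Fin p) (Fin p) ℝ, IsCorrelationMatrix S → S.rank = d p →
      ∀ (Ω : Type*) [MeasurableSpace Ω] (P : Measure Ω) [IsProbabilityMeasure P]
        (X : Ω → EuclideanSpace ℝ (Fin p)), HasLaw X (multivariateGaussian 0 S) P →
        1 - ε < P.real {ω | maxNorm (X ω) / rexBound (d p) p (d p) ≤ 1} := by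
  have hloglog := Real.tendsto_log_atTop.comp tendsto_log_natCast
  have h₁ : ∀ᶠ p : ℕ in atTop, Real.exp (-(Real.log (Real.log p) ^ 2 * d p / Real.log p ^ 2 / 2048))
      < ε / 2 :=
    (Real.tendsto_exp_neg_atTop_nhds_zero.comp
      (hd.atTop_div_const (by norm_num))).eventually_lt_const (half_pos hε)
  have h₂ : ∀ᶠ p : ℕ in atTop, Real.exp (-(Real.log (Real.log p) / 4)) < ε / 2 :=
    (Real.tendsto_exp_neg_atTop_nhds_zero.comp
      (hloglog.atTop_div_const (by norm_num))).eventually_lt_const (half_pos hε)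
  have h₃ : ∀ᶠ p : ℕ in atTop, Real.log (Real.log p) ^ 2 ≤ Real.log p / 3 := by
    have h := (Real.isLittleO_pow_log_id_atTop (n := 2)).bound (by norm_num : (0 : ℝ) < 1 / 3)
    filter_upwards [tendsto_log_natCast.eventually h,
      tendsto_log_natCast.eventually_ge_atTop 1] with p hp hp1
    simp only [norm_pow, Real.norm_eq_abs, sq_abs, id, abs_of_nonneg (zero_le_one.trans hp1)] at hp
    linarith
  obtain ⟨N, hN⟩ := eventually_atTop.1 (h₁.and (h₂.and (h₃.and
    ((tendsto_log_natCast.eventually_ge_atTop 1).and ((hd.eventually_ge_atTop 1).and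
    (eventually_ge_atTop 2))))))
  refine ⟨N, fun p hp S hS hrank Ω _ P _ X hX => ?_⟩
  obtain ⟨h₁, h₂, h₃, hlog, hT, hp2⟩ := hN p hp
  have hpd : 2 * Real.log p + 1 ≤ d p := by
    rw [one_le_div (by positivity)] at hT
    have hd0 : (0 : ℝ) ≤ d p := Nat.cast_nonneg _
    have h5 : Real.log p ^ 2 ≤ Real.log p / 3 * d p := hT.trans (by gcongr)
    have h6 : Real.log p ≤ d p / 3 :=
      le_of_mul_le_mul_left (by linarith [h5]) (zero_lt_one.trans_le hlog)
    linarith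
  have hd2 : 2 ≤ d p := by
    have : (2 : ℝ) ≤ d p := by linarith
    exact_mod_cast this
  have hE := hS.isEllipticalVector_stdGaussian hrank hX
  obtain ⟨l, hl, hPl⟩ := hE.exists_unit_vectors (by lia) hS
  have hle := stdGaussian_exists_abs_inner_gt_le hp2 hd2 hpd hlog hl
  rw [← hPl] at hle
  have hr : 0 < rexBound (d p) p (d p) := rexBound_pos (by positivity) hp2 hd2
  simp only [div_le_one hr]
  have hcompl := probReal_compl_eq_one_sub₀ (μ := P)
    (s := {ω | rexBound (d p) p (d p) < maxNorm (X ω)})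
    (nullMeasurableSet_lt aemeasurable_const (measurable_maxNorm.comp_aemeasurable hX.aemeasurable))
  simp only [Set.compl_ofPred, not_lt] at hcompl
  rw [hcompl]
  linarith

theorem theorem4 :
    -- Elliptical vectors: `ν d` is the law of `Z_d ∼ EC_d(0, I)`, and `‖Z_d‖² / u d → 1` in
    -- probability. The double limit is uniform over all correlation matrices of rank `d`.
    (∀ (ν : (d : ℕ) → Measure (EuclideanSpace ℝ (Fin d))) (u : ℕ → ℝ),
      (∀ d, IsEllipticalLaw 0 1 (ν d)) →
      (∀ η : ℝ, 0 < η →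
        Tendsto (fun d => (ν d).real {z | η < |‖z‖ ^ 2 / u d - 1|}) atTop (𝓝 0)) →
      ∀ δ : ℝ, 0 < δ → ∀ ε : ℝ, 0 < ε → ∃ N : ℕ, ∀ p d : ℕ, N ≤ p → N ≤ d →
        ∀ S : Matrix (Fin p) (Fin p) ℝ, IsCorrelationMatrix S → S.rank = d →
        ∀ (Ω : Type*) [MeasurableSpace Ω] (P : Measure Ω) [IsProbabilityMeasure P]
          (X : Ω → EuclideanSpace ℝ (Fin p)), IsEllipticalVector (ν d) S X P →
          P.real {ω | maxNorm (X ω) / rexBound (u d) p d > 1 + δ} < ε) ∧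
    -- Gaussian vectors, with `u_d = d`.
    (∀ δ : ℝ, 0 < δ → ∀ ε : ℝ, 0 < ε → ∃ N : ℕ, ∀ p d : ℕ, N ≤ p → N ≤ d →
        ∀ S : Matrix (Fin p) (Fin p) ℝ, IsCorrelationMatrix S → S.rank = d →
        ∀ (Ω : Type*) [MeasurableSpace Ω] (P : Measure Ω) [IsProbabilityMeasure P]
          (X : Ω → EuclideanSpace ℝ (Fin p)), HasLaw X (multivariateGaussian 0 S) P →
          P.real {ω | maxNorm (X ω) / rexBound d p d > 1 + δ} < ε) ∧
    -- Gaussian vectors of high rank `d = d(p)`.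
    (∀ d : ℕ → ℕ,
      Tendsto (fun p : ℕ => (Real.log (Real.log p)) ^ 2 * (d p : ℝ) / (Real.log p) ^ 2)
        atTop atTop →
      ∀ ε : ℝ, 0 < ε → ∃ N : ℕ, ∀ p : ℕ, N ≤ p →
        ∀ S : Matrix (Fin p) (Fin p) ℝ, IsCorrelationMatrix S → S.rank = d p →
        ∀ (Ω : Type*) [MeasurableSpace Ω] (P : Measure Ω) [IsProbabilityMeasure P]
          (X : Ω → EuclideanSpace ℝ (Fin p)), HasLaw X (multivariateGaussian 0 S) P →
          1 - ε < P.real {ω | maxNorm (X ω) / rexBound (d p) p (d p) ≤ 1}) := by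
  refine ⟨?_, ?_, ?_⟩
  · intro ν u hν hu δ hδ ε hε
    obtain ⟨N, hN⟩ := elliptical_rex_bound ν u hν hu hδ hε
    exact ⟨N, fun p d hp hd S hS _ => hN p d hp hd S hS⟩
  · intro δ hδ ε hε
    obtain ⟨N, hN⟩ := elliptical_rex_bound (fun d => stdGaussian (EuclideanSpace ℝ (Fin d)))
      (fun d => d) isEllipticalLaw_stdGaussian (fun η hη => tendsto_stdGaussian_norm_sq_div hη)
      hδ hε
    exact ⟨N, fun p d hp hd S hS hrank Ω _ P _ X hX =>
      hN p d hp hd S hS Ω P X (hS.isEllipticalVector_stdGaussian hrank hX)⟩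
  · intro d hd ε hε
    exact gaussian_rex_bound_high_rank d hd hε
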